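/- Setting. Let $(\Omega,\mathcal F,\mathbb P)$ be a probability space with a filtration carrying a scalar Lévy process $X=X^c+X^d$ with $X_0=0$ and characteristic triplet $(\mu,\sigma^2,\nu)$ (truncation $x1_{|x|\le 1}$), where $X^c$ is its continuous part (Brownian motion with drift, triplet $(\mu,\sigma^2,0)$) and $X^d$ its pure jump part (triplet $(0,0,\nu)$). Let $\psi^c,\psi^d$ be their characteristic exponents. Let $T_t,U_t$ be time changes (increasing càdlàg families of finite stopping times) such that $X^c$ is a.s. constant on all intervals $[T_{t^-},T_t]$ and $X^d$ is a.s. constant on all intervals $[U_{t^-},U_t]$, and put $X_{T,U}(t)=X^c_{T_t}+X^d_{U_t}$ and $M_t(\theta)=\exp\big(i\theta X_{T,U}(t)-T_t\psi^c(\theta)-U_t\psi^d(\theta)\big)$. Let $r\in\mathbb R$, $S_0>0$, and let $\theta_0\in\mathbb C$ be such that $\mathbb E[e^{i\theta_0X^d_t}]$ is defined and $\mathbb E[M_t(\theta_0)]=1$ for all $t\ge0$, and such that $$S_t=S_0e^{rt}M_t(\theta_0)$$ is a.s. a positive real number. Write $Y_t=\log S_t$, $\tilde S_t=e^{-rt}S_t$,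 and let $\langle Y\rangle_t$ be the quadratic variation of $Y$ on $[0,t]$, i.e. the limit in probability of $\sum_i(Y_{t_{i+1}}-Y_{t_i})^2$ over partitions of $[0,t]$ with mesh tending to $0$. Let $(\mathcal G_t)$ be the market filtration, to which $Y$ is adapted; $\mathbb E_{t_0}$ is conditional expectation given $\mathcal G_{t_0}$, computed with regular conditional distributions. For $t_0<t$ let $$\Phi_{t_0}(z,w)=\mathbb E_{t_0}\Big[\exp\big(iz\log(\tilde S_t/\tilde S_{t_0})+iw(\langle Y\rangle_t-\langle Y\rangle_{t_0})\big)\Big]$$ at all $(z,w)\in\mathbb C^2$ where the integrand is integrable. Proposition. Fix $t_0<t$. Let $F:\mathbb R^2\to[0,\infty)$ be a Borel payoff (a payoff given only for $y\ge0$ is extended by $0$) whose Fourier transform $\hat F(z,w)=\int_{\mathbb R^2}e^{izx+iwy}F(x,y)\,dx\,dy$ is analytic in $$\Sigma_F=\{(z,w):\ \text{the integral } \hat F(z,w)\text{ converges absolutely},\ \alpha_1<\operatorname{Im}z<\alpha_2,\ \beta_1<\operatorname{Im}w<\beta_2\},$$ with $\alpha_j,\beta_j\in\overline{\mathbb R}$.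 Then almost surely the following holds. Suppose that $F$ is integrable for the $t_0$-conditional law of $(Y_t,\langle Y\rangle_t)$, that $\Phi_{t_0}$ is analytic in $$\Sigma_\Phi=\{(z,w):\ \Phi_{t_0}(z,w)\text{ is defined},\ \gamma_1<\operatorname{Im}z<\gamma_2,\ \eta_1<\operatorname{Im}w<\eta_2\},$$ with $\gamma_j,\eta_j\in\overline{\mathbb R}$, and that $\Sigma_F\cap\Sigma_\Phi^*\neq\emptyset$, where $^*$ denotes complex conjugation. Then for every multi-line $L_{k_1,k_2}=\{(x+ik_1,y+ik_2):x,y\in\mathbb R\}\subset\Sigma_F\cap\Sigma_\Phi^*$ such that $\Phi_{t_0}$ is integrable (with respect to $dx\,dy$) along the conjugate multi-line $L_{-k_1,-k_2}\subset\Sigma_\Phi$, the integral below converges absolutely and $$\mathbb E_{t_0}\big[e^{-r(t-t_0)}F(Y_t,\langle Y\rangle_t)\big]=\frac{e^{-r(t-t_0)}}{4\pi^2}\int_{ik_1-\infty}^{ik_1+\infty}\int_{ik_2-\infty}^{ik_2+\infty}e^{-iw\langle Y\rangle_{t_0}}S_{t_0}^{-iz}e^{-r(t-t_0)iz}\,\Phi_{t_0}(-z,-w)\,\hat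 F(z,w)\,dz\,dw,$$ where $z$ runs over $ik_1+\mathbb R$ and $w$ over $ik_2+\mathbb R$. -/

import Mathlib

open MeasureTheory ProbabilityTheory Filter Topology Complex
open scoped NNReal

namespace DTCPricing

noncomputable section

/-! ### Lévy processes and time changes -/

/-- Right continuous with left limits. -/
def IsCadlag (f : ℝ≥0 → ℝ) : Prop :=
  ∀ t, ContinuousWithinAt f (Set.Ici t) t ∧ ∃ l, Tendsto f (𝓝[<] t) (𝓝 l)

/-- `ν` is a Lévy measure on the line. -/
def IsLevyMeasure (ν : Measure ℝ) : Prop :=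
  ν {0} = 0 ∧ Integrable (fun x : ℝ => min 1 (x ^ 2)) ν

/-- The Lévy–Khintchine exponent of the triplet `(b, a, ν)`, with the truncation function
`x 1_{|x| ≤ 1}`, at a complex argument `θ`. -/
def levyExponent (b a : ℝ) (ν : Measure ℝ) (θ : ℂ) : ℂ :=
  I * b * θ - a * θ ^ 2 / 2 +
    ∫ x : ℝ, (cexp (I * θ * x) - 1 - I * θ * (if |x| ≤ 1 then (x : ℂ) else 0)) ∂ν

/-- `X` is a scalar Lévy process started at `0`, with characteristic triplet `(b, a, ν)`,
on the filtration `ℱ`. -/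
structure IsLevyProcess {Ω : Type*} {mΩ : MeasurableSpace Ω} (P : Measure Ω)
    (ℱ : Filtration ℝ≥0 mΩ) (X : ℝ≥0 → Ω → ℝ) (b a : ℝ) (ν : Measure ℝ) : Prop where
  nonneg_variance : 0 ≤ a
  levyMeasure : IsLevyMeasure ν
  adapted : Adapted ℱ X
  zero : ∀ᵐ ω ∂P, X 0 ω = 0
  cadlag : ∀ᵐ ω ∂P, IsCadlag (fun t => X t ω)
  indep_increments : ∀ s t, s ≤ t →
    Indep (MeasurableSpace.comap (fun ω => X t ω - X s ω) inferInstance) (ℱ s) P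
  law_increments : ∀ s t, s ≤ t → ∀ u : ℝ,
    charFun (P.map (fun ω => X t ω - X s ω)) u
      = cexp (((t : ℝ) - (s : ℝ) : ℝ) * levyExponent b a ν u)

/-- A (finite) stochastic time change: an increasing càdlàg family of stopping times. The left
limits exist by monotonicity. -/
structure IsTimeChange {Ω : Type*} {mΩ : MeasurableSpace Ω} (P : Measure Ω)
    (ℱ : Filtration ℝ≥0 mΩ) (T : ℝ≥0 → Ω → ℝ≥0) : Prop where
  stopping : ∀ t, IsStoppingTime ℱ (fun ω => ((T t ω : ℝ≥0) : WithTop ℝ≥0))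
  mono : ∀ᵐ ω ∂P, Monotone (fun t => T t ω)
  right_cont : ∀ᵐ ω ∂P, ∀ t, ContinuousWithinAt (fun s => T s ω) (Set.Ici t) t

/-- `X` is `T`-continuous: almost surely constant on all the intervals `[T_{t-}, T_t]`. -/
def IsTimeChangeContinuous {Ω : Type*} {mΩ : MeasurableSpace Ω} (P : Measure Ω)
    (X : ℝ≥0 → Ω → ℝ) (T : ℝ≥0 → Ω → ℝ≥0) : Prop :=
  ∀ᵐ ω ∂P, ∀ t, ∀ u ∈ Set.Icc (Function.leftLim (fun s => T s ω) t) (T t ω),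
    X u ω = X (T t ω) ω

/-- A scalar Lévy process `X` of triplet `(μ, σ², ν)` with its continuous part `Xc` (a Brownian
motion with drift, triplet `(μ, σ², 0)`) and its discontinuous part `Xd` (a pure jump Lévy
process, triplet `(0, 0, ν)`), together with two time changes `T`, `U` such that `Xc` is
`T`-continuous and `Xd` is `U`-continuous. -/
structure DecoupledTimeChange {Ω : Type*} {mΩ : MeasurableSpace Ω} (P : Measure Ω)
    (ℱ : Filtration ℝ≥0 mΩ) where
  (μ σ : ℝ)
  ν : Measure ℝ
  (X Xc Xd : ℝ≥0 → Ω → ℝ)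
  (T U : ℝ≥0 → Ω → ℝ≥0)
  levy : IsLevyProcess P ℱ X μ (σ ^ 2) ν
  levy_cont : IsLevyProcess P ℱ Xc μ (σ ^ 2) 0
  continuous_cont : ∀ᵐ ω ∂P, Continuous (fun t => Xc t ω)
  levy_jump : IsLevyProcess P ℱ Xd 0 0 ν
  decomposition : ∀ᵐ ω ∂P, ∀ t, X t ω = Xc t ω + Xd t ω
  timeChange_T : IsTimeChange P ℱ T
  timeChange_U : IsTimeChange P ℱ U
  continuous_T : IsTimeChangeContinuous P Xc T
  continuous_U : IsTimeChangeContinuous P Xd U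

namespace DecoupledTimeChange

variable {Ω : Type*} {mΩ : MeasurableSpace Ω} {P : Measure Ω} {ℱ : Filtration ℝ≥0 mΩ}

/-- The decoupled time-changed process `X_{T,U}`. -/
def process (D : DecoupledTimeChange P ℱ) (t : ℝ≥0) (ω : Ω) : ℝ :=
  D.Xc (D.T t ω) ω + D.Xd (D.U t ω) ω

/-- The characteristic exponent of the continuous part. -/
def psiC (D : DecoupledTimeChange P ℱ) (θ : ℂ) : ℂ := levyExponent D.μ (D.σ ^ 2) 0 θ

/-- The characteristic exponent of the discontinuous part. -/
def psiD (D : DecoupledTimeChange P ℱ) (θ : ℂ) : ℂ := levyExponent 0 0 D.ν θ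

/-- The exponential `M_t(θ) = exp(i θ X_{T,U} - T_t ψ^c(θ) - U_t ψ^d(θ))`. -/
def expMart (D : DecoupledTimeChange P ℱ) (θ : ℂ) (t : ℝ≥0) (ω : Ω) : ℂ :=
  cexp (I * θ * (D.process t ω : ℂ) - ((D.T t ω : ℝ) : ℂ) * D.psiC θ
    - ((D.U t ω : ℝ) : ℂ) * D.psiD θ)

/-- The natural parameter set `Θ₀`: those `θ` for which `E[exp(i θ Xd_t)]` is defined and
`E[M_t(θ)] = 1`, for all `t`. (The last equation forces `M_t(θ)` to be integrable.) -/
def naturalParameterSet (D : DecoupledTimeChange P ℱ) : Set ℂ :=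
  {θ | (∀ t, Integrable (fun ω => cexp (I * θ * (D.Xd t ω : ℂ))) P) ∧
    ∀ t, ∫ ω, D.expMart θ t ω ∂P = 1}

/-- `S₀ e^{rt} M_t(θ₀)`, as a complex number. -/
def assetC (D : DecoupledTimeChange P ℱ) (r S₀ : ℝ) (θ₀ : ℂ) (t : ℝ≥0) (ω : Ω) : ℂ :=
  (S₀ : ℂ) * cexp ((r * (t : ℝ) : ℝ) : ℂ) * D.expMart θ₀ t ω

/-- `θ₀` makes the asset value a (positive) real number. -/
def IsRealAsset (D : DecoupledTimeChange P ℱ) (r S₀ : ℝ) (θ₀ : ℂ) : Prop :=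
  ∀ t, ∀ᵐ ω ∂P, (D.assetC r S₀ θ₀ t ω).im = 0 ∧ 0 < (D.assetC r S₀ θ₀ t ω).re

/-- The asset price `S_t` (to be used when `IsRealAsset` holds). -/
def asset (D : DecoupledTimeChange P ℱ) (r S₀ : ℝ) (θ₀ : ℂ) (t : ℝ≥0) (ω : Ω) : ℝ :=
  (D.assetC r S₀ θ₀ t ω).re

/-- The discounted price `e^{-rt} S_t`. -/
def discounted (D : DecoupledTimeChange P ℱ) (r S₀ : ℝ) (θ₀ : ℂ) (t : ℝ≥0) (ω : Ω) : ℝ :=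
  Real.exp (-(r * t)) * D.asset r S₀ θ₀ t ω

/-- The log-price `Y_t = log S_t`. -/
def logPrice (D : DecoupledTimeChange P ℱ) (r S₀ : ℝ) (θ₀ : ℂ) (t : ℝ≥0) (ω : Ω) : ℝ :=
  Real.log (D.asset r S₀ θ₀ t ω)

end DecoupledTimeChange

/-! ### Quadratic variation -/

/-- A partition `0 = π₀ ≤ π₁ ≤ ⋯ ≤ πₙ = t` of `[0, t]`. -/
structure TimePartition (t : ℝ≥0) where
  n : ℕ
  pt : ℕ → ℝ≥0
  mono : Monotone pt
  zero : pt 0 = 0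
  last : pt n = t

/-- The mesh `|π|`. -/
def TimePartition.mesh {t : ℝ≥0} (π : TimePartition t) : ℝ≥0 :=
  (Finset.range π.n).sup (fun i => π.pt (i + 1) - π.pt i)

/-- The sum of squared increments of `Y` along `π`. -/
def TimePartition.sumSq {Ω : Type*} {t : ℝ≥0} (π : TimePartition t) (Y : ℝ≥0 → Ω → ℝ)
    (ω : Ω) : ℝ :=
  ∑ i ∈ Finset.range π.n, (Y (π.pt (i + 1)) ω - Y (π.pt i) ω) ^ 2

/-- `Q` is the quadratic variation of `Y` on `[0, t]`: the limit in probability of the sums of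
squared increments as the mesh goes to `0`. -/
def IsQuadVarAt {Ω : Type*} {mΩ : MeasurableSpace Ω} (P : Measure Ω)
    (Y : ℝ≥0 → Ω → ℝ) (t : ℝ≥0) (Q : Ω → ℝ) : Prop :=
  Measurable Q ∧
    TendstoInMeasure P (fun (π : TimePartition t) ω => π.sumSq Y ω)
      (comap TimePartition.mesh (𝓝 0)) Q

open Classical in
/-- The quadratic variation `⟨Y⟩_t`, unique up to null sets. It exists for every semimartingale
`Y`; it is set to `0` where the limit does not exist. -/
def quadVar {Ω : Type*} {mΩ : MeasurableSpace Ω} (P : Measure Ω)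
    (Y : ℝ≥0 → Ω → ℝ) (t : ℝ≥0) : Ω → ℝ :=
  if h : ∃ Q : Ω → ℝ, IsQuadVarAt P Y t Q then h.choose else fun _ => 0

/-! ### Conditional laws -/

/-- The regular conditional law of the random vector `Z` given the σ-algebra `𝓗`. -/
def condLaw {Ω : Type*} {mΩ : MeasurableSpace Ω} (P : Measure Ω) [IsFiniteMeasure P]
    (𝓗 : MeasurableSpace Ω) (Z : Ω → ℝ × ℝ) (ω : Ω) : Measure (ℝ × ℝ) :=
  @condDistrib Ω Ω (ℝ × ℝ) _ _ _ mΩ 𝓗 Z id P _ ω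

/-- Integrating against the conditional law computes the conditional expectation. -/
theorem condExp_eq_integral_condLaw {Ω : Type*} {mΩ : MeasurableSpace Ω} (P : Measure Ω)
    [IsFiniteMeasure P] (𝓗 : MeasurableSpace Ω) (h𝓗 : 𝓗 ≤ mΩ) (Z : Ω → ℝ × ℝ)
    (hZ : Measurable[mΩ] Z) (G : ℝ × ℝ → ℝ) (hG : Measurable G)
    (hint : Integrable (fun ω => G (Z ω)) P) :
    P[fun ω => G (Z ω) | 𝓗] =ᵐ[P] fun ω => ∫ q, G q ∂(condLaw P 𝓗 Z ω) := by
  have hid : @Measurable Ω Ω mΩ 𝓗 id := fun s hs => h𝓗 s hs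
  have hZ' : @AEMeasurable _ _ _ mΩ Z P := @Measurable.aemeasurable _ _ mΩ _ _ P hZ
  have := condExp_ae_eq_integral_condDistrib (mβ := 𝓗) (μ := P) (X := id) hid hZ'
    hG.stronglyMeasurable hint
  rwa [MeasurableSpace.comap_id] at this

/-! ### Transforms and multi-strips -/

/-- The set of `(z, w) ∈ ℂ²` at which the Fourier integral of `F` converges absolutely. -/
def fourierDomain (F : ℝ × ℝ → ℝ) : Set (ℂ × ℂ) :=
  {p | Integrable (fun q : ℝ × ℝ => cexp (I * p.1 * q.1 + I * p.2 * q.2) * (F q : ℂ))}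

/-- The Fourier transform `F̂(z, w) = ∫∫ e^{izx + iwy} F(x, y) dx dy`. -/
def fourier (F : ℝ × ℝ → ℝ) (p : ℂ × ℂ) : ℂ :=
  ∫ q : ℝ × ℝ, cexp (I * p.1 * q.1 + I * p.2 * q.2) * (F q : ℂ)

/-- The set of `(z, w) ∈ ℂ²` at which the characteristic function of `ρ` is finite. -/
def charDomain (ρ : Measure (ℝ × ℝ)) : Set (ℂ × ℂ) :=
  {p | Integrable (fun q : ℝ × ℝ => cexp (I * p.1 * q.1 + I * p.2 * q.2)) ρ}

/-- The characteristic function of `ρ` with complex arguments. -/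
def charFunC (ρ : Measure (ℝ × ℝ)) (p : ℂ × ℂ) : ℂ :=
  ∫ q : ℝ × ℝ, cexp (I * p.1 * q.1 + I * p.2 * q.2) ∂ρ

/-- The part of the domain `Θ` lying in an open multi-strip, with possibly infinite bounds. -/
def multiStrip (Θ : Set (ℂ × ℂ)) (a₁ a₂ b₁ b₂ : EReal) : Set (ℂ × ℂ) :=
  {p | p ∈ Θ ∧ (a₁ < (p.1.im : EReal) ∧ (p.1.im : EReal) < a₂) ∧
    (b₁ < (p.2.im : EReal) ∧ (p.2.im : EReal) < b₂)}

/-- The complex conjugate of a subset of `ℂ²`. -/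
def conjSet (A : Set (ℂ × ℂ)) : Set (ℂ × ℂ) :=
  {p | ((starRingEnd ℂ) p.1, (starRingEnd ℂ) p.2) ∈ A}

/-- The point `(x + i k₁, y + i k₂)`. -/
def linePoint (k₁ k₂ : ℝ) (q : ℝ × ℝ) : ℂ × ℂ := ((q.1 : ℂ) + I * k₁, (q.2 : ℂ) + I * k₂)

/-- The multi-line `L_{k₁,k₂}`. -/
def multiLine (k₁ k₂ : ℝ) : Set (ℂ × ℂ) := Set.range (linePoint k₁ k₂)

namespace DecoupledTimeChange

variable {Ω : Type*} {mΩ : MeasurableSpace Ω} {P : Measure Ω} {ℱ : Filtration ℝ≥0 mΩ}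

/-- The quadratic variation `⟨Y⟩_t` of the log-price (the total realized variance). -/
def realizedVar (D : DecoupledTimeChange P ℱ) (r S₀ : ℝ) (θ₀ : ℂ) (t : ℝ≥0) : Ω → ℝ :=
  quadVar P (D.logPrice r S₀ θ₀) t

/-- The conditional law of `(Y_t, ⟨Y⟩_t)` given the information `𝓗`. -/
def stateLaw [IsFiniteMeasure P] (D : DecoupledTimeChange P ℱ) (r S₀ : ℝ) (θ₀ : ℂ)
    (𝓗 : MeasurableSpace Ω) (t : ℝ≥0) (ω : Ω) : Measure (ℝ × ℝ) :=
  condLaw P 𝓗 (fun ω' => (D.logPrice r S₀ θ₀ t ω', D.realizedVar r S₀ θ₀ t ω')) ω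

/-- The conditional law, given the information `𝓗`, of the increments from `t₀` to `t` of the
discounted log-price and of the realized variance. -/
def incrementLaw [IsFiniteMeasure P] (D : DecoupledTimeChange P ℱ) (r S₀ : ℝ) (θ₀ : ℂ)
    (𝓗 : MeasurableSpace Ω) (t₀ t : ℝ≥0) (ω : Ω) : Measure (ℝ × ℝ) :=
  condLaw P 𝓗 (fun ω' =>
    (Real.log (D.discounted r S₀ θ₀ t ω' / D.discounted r S₀ θ₀ t₀ ω'),
      D.realizedVar r S₀ θ₀ t ω' - D.realizedVar r S₀ θ₀ t₀ ω')) ω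

/-- The conditional characteristic function `Φ_{t₀}(z, w)` of these increments. -/
def Phi [IsFiniteMeasure P] (D : DecoupledTimeChange P ℱ) (r S₀ : ℝ) (θ₀ : ℂ)
    (𝓗 : MeasurableSpace Ω) (t₀ t : ℝ≥0) (ω : Ω) : ℂ × ℂ → ℂ :=
  charFunC (D.incrementLaw r S₀ θ₀ 𝓗 t₀ t ω)

/-- The integrand
`e^{-iw⟨Y⟩_{t₀}} S_{t₀}^{-iz} e^{-r(t-t₀)iz} Φ_{t₀}(-z, -w) F̂(z, w)` of the pricing formula. -/
def pricingIntegrand [IsFiniteMeasure P] (D : DecoupledTimeChange P ℱ) (r S₀ : ℝ) (θ₀ : ℂ)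
    (𝓗 : MeasurableSpace Ω) (t₀ t : ℝ≥0) (F : ℝ × ℝ → ℝ) (ω : Ω) (p : ℂ × ℂ) : ℂ :=
  cexp (-(I * p.2 * (D.realizedVar r S₀ θ₀ t₀ ω : ℂ))) *
    (D.asset r S₀ θ₀ t₀ ω : ℂ) ^ (-(I * p.1)) *
    cexp (-(((r * ((t : ℝ) - (t₀ : ℝ)) : ℝ) : ℂ) * I * p.1)) *
    D.Phi r S₀ θ₀ 𝓗 t₀ t ω (-p.1, -p.2) * fourier F p

end DecoupledTimeChange

end

end DTCPricing

/-! Given the information at `t₀`, the pair `(Y_t, ⟨Y⟩_t)` is the increment pair plus the known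
vector `a = (Y_{t₀} + r(t - t₀), ⟨Y⟩_{t₀})`. So its conditional law is the increment law `ρ`
translated by `a` (`stateLaw_ae_eq`), and for almost every `ω` the claim becomes a deterministic one
about `ρ` and the payoff `F(· + a)`. Translating `F` produces exactly the prefactors of the
integrand (`pricingIntegrand_eq`).

On the multi-lines at heights `∓k`, `Φ` and `F̂` are the ordinary transforms of the finite measure
`e^{k·q} ρ` and of the integrable function `e^{-k·q} F`. The weights cancel in the pairing, leaving
a Parseval formula (`integral_eq_integral_multiLine`).

As `F` need not be continuous, Parseval rests on a density: a finite measure with integrable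
characteristic function has its inversion integral `p` as density. After Gaussian damping this
follows from uniqueness of characteristic functions (`withDensity_gaussWeight_add_eq`). -/

namespace DTCPricing

/-! ### Conditional laws under shifts by known vectors. -/

section ConditionalLaw

/-- The shear `(b, y) ↦ (b, y + W b)` carries the joint law of `(X, Y)` to that of `(X, Y + W(X))`
and preserves the first marginal; uniqueness of disintegration does the rest. -/
theorem condDistrib_add_comp {α β : Type*} {mα : MeasurableSpace α} {mβ : MeasurableSpace β}
    {μ : Measure α} [IsFiniteMeasure μ] {X : α → β} (hX : Measurable X) {Y : α → ℝ × ℝ}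
    (hY : AEMeasurable Y μ) {W : β → ℝ × ℝ} (hW : Measurable W) :
    ∀ᵐ b ∂(μ.map X), condDistrib (fun a => Y a + W (X a)) X μ b
      = (condDistrib Y X μ b).map (fun y => y + W b) := by
  have hf : Measurable (fun q : β × (ℝ × ℝ) => q.2 + W q.1) := by fun_prop
  set κ : Kernel β (ℝ × ℝ) :=
    (Kernel.id ×ₖ condDistrib Y X μ).map (fun q : β × (ℝ × ℝ) => q.2 + W q.1) with hκ
  have : IsFiniteKernel κ := by rw [hκ]; infer_instance
  have hκb : ∀ b, κ b = (condDistrib Y X μ b).map (fun y => y + W b) := by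
    intro b
    rw [hκ, Kernel.map_apply _ hf, Kernel.prod_apply, Kernel.id_apply, Measure.dirac_prod,
      Measure.map_map hf (by fun_prop)]
    rfl
  have key : μ.map (fun a => (X a, Y a + W (X a))) = μ.map X ⊗ₘ κ := by
    have h1 : μ.map (fun a => (X a, Y a + W (X a)))
        = (μ.map (fun a => (X a, Y a))).map (fun q => (q.1, q.2 + W q.1)) := by
      rw [AEMeasurable.map_map_of_aemeasurable (by fun_prop) (by fun_prop)]
      rfl
    rw [h1, ← compProd_map_condDistrib hY]
    ext s hs
    rw [Measure.map_apply (by fun_prop) hs, Measure.compProd_apply hs,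
      Measure.compProd_apply ((by fun_prop : Measurable
        (fun q : β × (ℝ × ℝ) => (q.1, q.2 + W q.1))) hs)]
    refine lintegral_congr fun b => ?_
    rw [hκb, Measure.map_apply (by fun_prop) (measurable_prodMk_left hs)]
    rfl
  filter_upwards [condDistrib_ae_eq_of_measure_eq_compProd X (by fun_prop) key] with b hb
  rw [hb, hκb]

theorem condLaw_congr {Ω : Type*} {mΩ : MeasurableSpace Ω} (P : Measure Ω) [IsFiniteMeasure P]
    (𝓗 : MeasurableSpace Ω) {Z Z' : Ω → ℝ × ℝ} (h : Z =ᵐ[P] Z') :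
    condLaw P 𝓗 Z = condLaw P 𝓗 Z' := by
  unfold condLaw
  rw [condDistrib_congr_left h]

theorem condLaw_add {Ω : Type*} {mΩ : MeasurableSpace Ω} (P : Measure Ω) [IsFiniteMeasure P]
    {𝓗 : MeasurableSpace Ω} (h𝓗 : 𝓗 ≤ mΩ) {Z W : Ω → ℝ × ℝ} (hZ : AEMeasurable Z P)
    (hW : Measurable[𝓗] W) :
    ∀ᵐ ω ∂P, condLaw P 𝓗 (fun ω' => Z ω' + W ω') ω
      = (condLaw P 𝓗 Z ω).map (fun q => q + W ω) := by
  have hid : @Measurable Ω Ω mΩ 𝓗 id := fun s hs => h𝓗 s hs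
  -- Conditioning on `𝓗` is conditioning on the identity map from `(Ω, mΩ)` to `(Ω, 𝓗)`.
  exact ae_of_ae_map (@Measurable.aemeasurable _ _ mΩ 𝓗 _ P hid)
    (condDistrib_add_comp (mβ := 𝓗) (X := id) hid hZ hW)

end ConditionalLaw

/-! ### Measurability of the quadratic variation. -/

section QuadraticVariation

/-- Uniform partitions have arbitrarily small mesh. Nontriviality of the filter is what allows an
a.e. convergent sequence to be extracted from the limit in probability. -/
instance TimePartition.neBot_comap_mesh (t : ℝ≥0) :
    NeBot (comap (TimePartition.mesh (t := t)) (𝓝 0)) := by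
  rw [comap_neBot_iff]
  intro s hs
  obtain ⟨ε, hε, hs⟩ := Metric.mem_nhds_iff.1 hs
  obtain ⟨n, hn⟩ := exists_nat_gt ((t : ℝ) / ε)
  have hn0 : (0 : ℝ) < n + 1 := by positivity
  have hstep : (t : ℝ) / (n + 1) < ε := by
    rw [div_lt_iff₀ hε] at hn
    rw [div_lt_iff₀ hn0]
    nlinarith
  refine ⟨⟨n + 1, fun i => (i : ℝ≥0) * (t / (n + 1)), ?_, by simp, ?_⟩, hs ?_⟩
  · intro i j hij
    dsimp only
    gcongr
  · push_cast
    field_simp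
  · rw [Metric.mem_ball, NNReal.dist_eq, NNReal.coe_zero, sub_zero, abs_of_nonneg (by positivity)]
    refine lt_of_le_of_lt ?_ hstep
    have : TimePartition.mesh (t := t) ⟨n + 1, fun i => (i : ℝ≥0) * (t / (n + 1)), by
        intro i j hij; dsimp only; gcongr, by simp, by push_cast; field_simp⟩
        ≤ t / (n + 1) := by
      refine Finset.sup_le fun i _ => ?_
      dsimp only
      rw [← tsub_mul]
      simp
    exact_mod_cast this

theorem TimePartition.measurable_sumSq {Ω : Type*} {mΩ : MeasurableSpace Ω}
    {𝒢 : Filtration ℝ≥0 mΩ} {Y : ℝ≥0 → Ω → ℝ} (hY : Adapted 𝒢 Y) {t : ℝ≥0}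
    (π : TimePartition t) : Measurable[𝒢 t] (π.sumSq Y) := by
  have hpt : ∀ i ≤ π.n, Measurable[𝒢 t] (Y (π.pt i)) := fun i hi =>
    (hY (π.pt i)).mono (𝒢.mono ((π.mono hi).trans_eq π.last)) le_rfl
  unfold TimePartition.sumSq
  refine Finset.measurable_sum _ fun i hi => ?_
  have hi' := Finset.mem_range.1 hi
  exact ((hpt (i + 1) hi').sub (hpt i hi'.le)).pow_const 2

theorem measurable_quadVar {Ω : Type*} {mΩ : MeasurableSpace Ω} (P : Measure Ω)
    (Y : ℝ≥0 → Ω → ℝ) (t : ℝ≥0) : Measurable (quadVar P Y t) := by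
  unfold quadVar
  split_ifs with h
  · exact h.choose_spec.1
  · exact measurable_const

/-- The chosen limit is measurable only for the full σ-algebra. Sums over partitions of `[0, t]` are
`𝒢 t`-measurable, and along a suitable sequence they converge almost everywhere, so their `limsup`
is a `𝒢 t`-measurable version. -/
theorem exists_measurable_quadVar_ae_eq {Ω : Type*} {mΩ : MeasurableSpace Ω} (P : Measure Ω)
    {𝒢 : Filtration ℝ≥0 mΩ} {Y : ℝ≥0 → Ω → ℝ} (hY : Adapted 𝒢 Y) (t : ℝ≥0) :
    ∃ Q : Ω → ℝ, Measurable[𝒢 t] Q ∧ quadVar P Y t =ᵐ[P] Q := by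
  unfold quadVar
  split_ifs with h
  · obtain ⟨π, -, hπ⟩ := h.choose_spec.2.exists_seq_tendsto_ae'
    refine ⟨fun ω => limsup (fun n => (π n).sumSq Y ω) atTop,
      Measurable.limsup fun n => (π n).measurable_sumSq hY, ?_⟩
    filter_upwards [hπ] with ω hω
    exact hω.limsup_eq.symm
  · exact ⟨fun _ => 0, measurable_const, ae_eq_rfl⟩

end QuadraticVariation

/-! ### The conditional law of the state as a translate. -/

namespace DecoupledTimeChange

variable {Ω : Type*} {mΩ : MeasurableSpace Ω} {P : Measure Ω} {ℱ 𝒢 : Filtration ℝ≥0 mΩ}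
  {D : DecoupledTimeChange P ℱ} {r S₀ : ℝ} {θ₀ : ℂ}

theorem IsRealAsset.ae_pos (h : D.IsRealAsset r S₀ θ₀) (t : ℝ≥0) :
    ∀ᵐ ω ∂P, 0 < D.asset r S₀ θ₀ t ω :=
  (h t).mono fun _ hω => hω.2

theorem log_discounted_div {t₀ t : ℝ≥0} {ω : Ω} (h₀ : 0 < D.asset r S₀ θ₀ t₀ ω)
    (h : 0 < D.asset r S₀ θ₀ t ω) :
    Real.log (D.discounted r S₀ θ₀ t ω / D.discounted r S₀ θ₀ t₀ ω)
      = D.logPrice r S₀ θ₀ t ω - D.logPrice r S₀ θ₀ t₀ ω - r * ((t : ℝ) - t₀) := by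
  unfold discounted logPrice
  rw [Real.log_div (by positivity) (by positivity), Real.log_mul (by positivity) h.ne',
    Real.log_mul (by positivity) h₀.ne', Real.log_exp, Real.log_exp]
  ring

theorem stateLaw_ae_eq [IsFiniteMeasure P] (hreal : D.IsRealAsset r S₀ θ₀)
    (hadapted : Adapted 𝒢 (D.logPrice r S₀ θ₀)) (t₀ t : ℝ≥0) :
    ∀ᵐ ω ∂P, D.stateLaw r S₀ θ₀ (𝒢 t₀) t ω
      = (D.incrementLaw r S₀ θ₀ (𝒢 t₀) t₀ t ω).map (fun q => q +
          (D.logPrice r S₀ θ₀ t₀ ω + r * ((t : ℝ) - t₀), D.realizedVar r S₀ θ₀ t₀ ω)) := by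
  obtain ⟨Q, hQm, hQ⟩ := exists_measurable_quadVar_ae_eq P hadapted t₀
  have hY : ∀ s, Measurable (D.logPrice r S₀ θ₀ s) := fun s => (hadapted s).mono (𝒢.le s) le_rfl
  have hV : ∀ s, Measurable (D.realizedVar r S₀ θ₀ s) := fun s => measurable_quadVar _ _ s
  set Z : Ω → ℝ × ℝ := fun ω =>
    (D.logPrice r S₀ θ₀ t ω - D.logPrice r S₀ θ₀ t₀ ω - r * ((t : ℝ) - t₀),
      D.realizedVar r S₀ θ₀ t ω - D.realizedVar r S₀ θ₀ t₀ ω) with hZdef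
  have hZ : Measurable Z := by
    have := hY t; have := hY t₀; have := hV t; have := hV t₀
    fun_prop
  -- The version `Q` replaces `⟨Y⟩_{t₀}` here so that the shift is genuinely `𝒢 t₀`-measurable.
  set W : Ω → ℝ × ℝ := fun ω => (D.logPrice r S₀ θ₀ t₀ ω + r * ((t : ℝ) - t₀), Q ω) with hWdef
  have hW : Measurable[𝒢 t₀] W := ((hadapted t₀).add_const _).prodMk hQm
  have hinc : D.incrementLaw r S₀ θ₀ (𝒢 t₀) t₀ t = condLaw P (𝒢 t₀) Z := by
    refine condLaw_congr P _ ?_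
    filter_upwards [hreal.ae_pos t₀, hreal.ae_pos t] with ω h₀ h
    rw [log_discounted_div h₀ h]
  have hstate : D.stateLaw r S₀ θ₀ (𝒢 t₀) t = condLaw P (𝒢 t₀) (fun ω => Z ω + W ω) := by
    refine condLaw_congr P _ ?_
    filter_upwards [hQ] with ω hω
    have hω' : D.realizedVar r S₀ θ₀ t₀ ω = Q ω := hω
    simp [hZdef, hWdef, hω']
  filter_upwards [condLaw_add P (𝒢.le t₀) hZ.aemeasurable hW, hQ] with ω h hω
  have hω' : D.realizedVar r S₀ θ₀ t₀ ω = Q ω := hω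
  rw [hstate, h, hinc, hω']

instance isProbabilityMeasure_incrementLaw [IsFiniteMeasure P] (D : DecoupledTimeChange P ℱ)
    (r S₀ : ℝ) (θ₀ : ℂ) (𝓗 : MeasurableSpace Ω) (t₀ t : ℝ≥0) (ω : Ω) :
    IsProbabilityMeasure (D.incrementLaw r S₀ θ₀ 𝓗 t₀ t ω) := by
  unfold incrementLaw condLaw
  infer_instance

end DecoupledTimeChange

noncomputable section

/-! ### Fourier inversion and Parseval for finite measures on the plane. -/

section FourierInversion

/-- The plane wave `e^{i(ξ₁ q₁ + ξ₂ q₂)}`. -/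
def planeWave (ξ q : ℝ × ℝ) : ℂ := cexp (I * ξ.1 * q.1 + I * ξ.2 * q.2)

/-- The Gaussian weight `e^{-(q₁² + q₂²)/2}`. -/
def gaussWeight (q : ℝ × ℝ) : ℝ := Real.exp (-(q.1 ^ 2 + q.2 ^ 2) / 2)

@[fun_prop]
theorem continuous_gaussWeight : Continuous gaussWeight := by
  unfold gaussWeight
  fun_prop

theorem gaussWeight_pos (q : ℝ × ℝ) : 0 < gaussWeight q := Real.exp_pos _

theorem gaussWeight_le_one (q : ℝ × ℝ) : gaussWeight q ≤ 1 :=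
  Real.exp_le_one_iff.2 (by nlinarith [sq_nonneg q.1, sq_nonneg q.2])

theorem gaussWeight_neg (q : ℝ × ℝ) : gaussWeight (-q) = gaussWeight q := by
  simp [gaussWeight]

theorem norm_planeWave (ξ q : ℝ × ℝ) : ‖planeWave ξ q‖ = 1 := by
  simp [planeWave, Complex.norm_exp]

theorem continuous_planeWave : Continuous (fun p : (ℝ × ℝ) × (ℝ × ℝ) => planeWave p.1 p.2) := by
  unfold planeWave
  fun_prop

@[fun_prop]
theorem continuous_planeWave_comp {α : Type*} [TopologicalSpace α] {f g : α → ℝ × ℝ}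
    (hf : Continuous f) (hg : Continuous g) : Continuous (fun a => planeWave (f a) (g a)) :=
  continuous_planeWave.comp (hf.prodMk hg)

theorem planeWave_add_left (ξ η q : ℝ × ℝ) :
    planeWave (ξ + η) q = planeWave ξ q * planeWave η q := by
  simp only [planeWave, ← Complex.exp_add, Prod.fst_add, Prod.snd_add]
  congr 1
  push_cast
  ring

theorem planeWave_comm (ξ q : ℝ × ℝ) : planeWave ξ q = planeWave q ξ := by
  unfold planeWave
  congr 1
  ring

theorem conj_planeWave (ξ q : ℝ × ℝ) :
    (starRingEnd ℂ) (planeWave ξ q) = planeWave (-ξ) q := by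
  simp only [planeWave, ← Complex.exp_conj]
  congr 1
  simp

theorem integrable_gaussWeight : Integrable gaussWeight := by
  have h := integrable_exp_neg_mul_sq (b := 1 / 2) (by norm_num)
  refine (h.mul_prod h).congr (ae_of_all _ fun q => ?_)
  simp only [gaussWeight, ← Real.exp_add]
  congr 1
  ring

theorem integral_planeWave_mul_gaussWeight (u : ℝ × ℝ) :
    ∫ q, planeWave u q * (gaussWeight q : ℂ) = 2 * Real.pi * gaussWeight u := by
  have h1 : ∀ s : ℝ, ∫ x : ℝ, cexp (I * s * x) * cexp (-(1 / 2) * x ^ 2)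
      = (2 * Real.pi : ℂ) ^ (1 / 2 : ℂ) * cexp (-s ^ 2 / 2) := by
    intro s
    rw [fourierIntegral_gaussian (by norm_num)]
    congr 2 <;> ring
  have h2 : ∀ q : ℝ × ℝ, planeWave u q * (gaussWeight q : ℂ)
      = (cexp (I * u.1 * q.1) * cexp (-(1 / 2) * q.1 ^ 2)) *
        (cexp (I * u.2 * q.2) * cexp (-(1 / 2) * q.2 ^ 2)) := by
    intro q
    simp only [planeWave, gaussWeight, Complex.ofReal_exp, ← Complex.exp_add]
    congr 1
    push_cast
    ring
  simp_rw [h2]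
  rw [Measure.volume_eq_prod, integral_prod_mul
    (f := fun x : ℝ => cexp (I * u.1 * x) * cexp (-(1 / 2) * x ^ 2))
    (g := fun x : ℝ => cexp (I * u.2 * x) * cexp (-(1 / 2) * x ^ 2)), h1, h1]
  have hpi : (2 * Real.pi : ℂ) ≠ 0 := by simp [Real.pi_ne_zero]
  have h3 : (2 * Real.pi : ℂ) ^ (1 / 2 : ℂ) * (2 * Real.pi : ℂ) ^ (1 / 2 : ℂ) = 2 * Real.pi := by
    rw [← Complex.cpow_add _ _ hpi]
    norm_num
  rw [mul_mul_mul_comm, h3, ← Complex.exp_add, gaussWeight, Complex.ofReal_exp]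
  congr 2
  push_cast
  ring

theorem integrable_planeWave_mul {μ : Measure (ℝ × ℝ)} {g : ℝ × ℝ → ℂ} (hg : Integrable g μ)
    (ξ : ℝ × ℝ) : Integrable (fun q => planeWave ξ q * g q) μ :=
  hg.bdd_mul (c := 1) (Continuous.aestronglyMeasurable (by fun_prop))
    (ae_of_all _ fun q => (norm_planeWave ξ q).le)

theorem integrable_planeWave_mul_prod {μ ν : Measure (ℝ × ℝ)} [SFinite μ] [SFinite ν]
    {f g : ℝ × ℝ → ℂ} (hf : Integrable f μ) (hg : Integrable g ν) :
    Integrable (fun p : (ℝ × ℝ) × (ℝ × ℝ) => planeWave p.1 p.2 * (f p.1 * g p.2)) (μ.prod ν) :=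
  (hf.mul_prod hg).bdd_mul (c := 1) continuous_planeWave.aestronglyMeasurable
    (ae_of_all _ fun p => (norm_planeWave p.1 p.2).le)

/-- The multiplication formula for the Fourier transform. -/
theorem integral_mul_integral_planeWave {μ ν : Measure (ℝ × ℝ)} [SFinite μ] [SFinite ν]
    {f g : ℝ × ℝ → ℂ} (hf : Integrable f μ) (hg : Integrable g ν) :
    ∫ ξ, f ξ * ∫ q, planeWave ξ q * g q ∂ν ∂μ = ∫ q, g q * ∫ ξ, planeWave q ξ * f ξ ∂μ ∂ν := by
  have h := integral_integral_swap
    (f := fun ξ q => planeWave ξ q * (f ξ * g q)) (integrable_planeWave_mul_prod hf hg)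
  simp_rw [← integral_const_mul]
  refine (Eq.trans ?_ h).trans ?_
  · refine integral_congr_ae (ae_of_all _ fun ξ => integral_congr_ae (ae_of_all _ fun q => ?_))
    simp only
    ring
  · refine integral_congr_ae (ae_of_all _ fun q => integral_congr_ae (ae_of_all _ fun ξ => ?_))
    simp only
    rw [planeWave_comm]
    ring

/-- The characteristic function of a measure on the plane. -/
def planeCharFun (ρ : Measure (ℝ × ℝ)) (ξ : ℝ × ℝ) : ℂ := ∫ q, planeWave ξ q ∂ρ

/-- The Fourier inversion integral of the characteristic function of `ρ`. -/
def inversionDensity (ρ : Measure (ℝ × ℝ)) (q : ℝ × ℝ) : ℂ :=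
  1 / (4 * Real.pi ^ 2) * ∫ η, planeWave (-η) q * planeCharFun ρ η

variable {ρ : Measure (ℝ × ℝ)}

theorem conj_planeCharFun (η : ℝ × ℝ) :
    (starRingEnd ℂ) (planeCharFun ρ η) = planeCharFun ρ (-η) := by
  simp only [planeCharFun, ← integral_conj, conj_planeWave]

/-- Conjugation amounts to `η ↦ -η`, which leaves the integral unchanged. Hence the inversion
integral is real and its positive and negative parts can serve as densities. -/
theorem conj_inversionDensity (q : ℝ × ℝ) :
    (starRingEnd ℂ) (inversionDensity ρ q) = inversionDensity ρ q := by
  simp only [inversionDensity, map_mul, ← integral_conj, conj_planeWave, conj_planeCharFun]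
  rw [integral_neg_eq_self (fun η => planeWave (-η) q * planeCharFun ρ η)]
  simp [map_ofNat]

theorem ofReal_re_inversionDensity (q : ℝ × ℝ) :
    ((inversionDensity ρ q).re : ℂ) = inversionDensity ρ q :=
  Complex.conj_eq_iff_re.1 (conj_inversionDensity q)

theorem continuous_inversionDensity (hφ : Integrable (planeCharFun ρ)) :
    Continuous (inversionDensity ρ) := by
  refine continuous_const.mul (continuous_of_dominated (bound := fun η => ‖planeCharFun ρ η‖)
    (fun q => ?_) (fun q => ae_of_all _ fun η => ?_) hφ.norm (ae_of_all _ fun η => by fun_prop))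
  · exact (Continuous.aestronglyMeasurable (by fun_prop)).mul hφ.aestronglyMeasurable
  · rw [norm_mul, norm_planeWave, one_mul]

theorem exists_norm_inversionDensity_le (ρ : Measure (ℝ × ℝ)) :
    ∃ C, ∀ q, ‖inversionDensity ρ q‖ ≤ C := by
  refine ⟨‖(1 / (4 * Real.pi ^ 2) : ℂ)‖ * ∫ η, ‖planeCharFun ρ η‖, fun q => ?_⟩
  rw [inversionDensity, norm_mul]
  gcongr
  refine (norm_integral_le_integral_norm _).trans_eq ?_
  simp [norm_planeWave]

theorem integral_mul_inversionDensity (hφ : Integrable (planeCharFun ρ)) {g : ℝ × ℝ → ℂ}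
    (hg : Integrable g) :
    ∫ q, g q * inversionDensity ρ q
      = 1 / (4 * Real.pi ^ 2) * ∫ η, planeCharFun ρ (-η) * ∫ q, planeWave η q * g q := by
  rw [integral_mul_integral_planeWave hφ.comp_neg hg, ← integral_const_mul]
  refine integral_congr_ae (ae_of_all _ fun q => ?_)
  simp only [inversionDensity]
  rw [← integral_neg_eq_self (fun η => planeWave (-η) q * planeCharFun ρ η)]
  simp only [neg_neg, planeWave_comm q]
  ring

/-- Both sides reduce to the integral of the characteristic function against a translated Gaussian,
because a modulated Gaussian is the transform of a translated one. -/
theorem integral_planeWave_mul_gaussWeight_measure [IsFiniteMeasure ρ]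
    (hφ : Integrable (planeCharFun ρ)) (ξ : ℝ × ℝ) :
    ∫ q, planeWave ξ q * gaussWeight q ∂ρ
      = ∫ q, (planeWave ξ q * gaussWeight q) * inversionDensity ρ q := by
  have hG : Integrable (fun q => (gaussWeight q : ℂ)) := integrable_gaussWeight.ofReal
  have hpi : (Real.pi : ℂ) ≠ 0 := by simp [Real.pi_ne_zero]
  rw [integral_mul_inversionDensity hφ (integrable_planeWave_mul hG ξ)]
  have h1 : ∀ η : ℝ × ℝ, ∫ q, planeWave η q * (planeWave ξ q * gaussWeight q)
      = 2 * Real.pi * gaussWeight (η + ξ) := by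
    intro η
    simp_rw [← mul_assoc, ← planeWave_add_left]
    exact integral_planeWave_mul_gaussWeight _
  -- The factor `1` is the function paired with `ρ` when the multiplication formula is applied
  -- below.
  have h2 : ∀ q : ℝ × ℝ, planeWave ξ q * (gaussWeight q : ℂ)
      = 1 / (2 * Real.pi) * (1 * ∫ η, planeWave q η * gaussWeight (η - ξ)) := by
    intro q
    have : ∫ η, planeWave q η * (gaussWeight (η - ξ) : ℂ)
        = ∫ η, planeWave q (η + ξ) * (gaussWeight η : ℂ) := by
      rw [← integral_add_right_eq_self _ ξ]
      simp
    simp_rw [this, planeWave_comm q, planeWave_add_left, mul_right_comm _ (planeWave ξ q)]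
    rw [integral_mul_const]
    simp_rw [planeWave_comm _ q]
    rw [integral_planeWave_mul_gaussWeight]
    field_simp
  simp_rw [h1, h2]
  rw [integral_const_mul, integral_mul_integral_planeWave (integrable_const 1)
    (hG.comp_sub_right ξ), ← integral_neg_eq_self]
  simp only [mul_one]
  rw [← integral_const_mul, ← integral_const_mul]
  refine integral_congr_ae (ae_of_all _ fun η => ?_)
  simp only [planeCharFun]
  rw [← gaussWeight_neg (η + ξ), neg_add']
  field_simp
  ring

theorem cexp_dual_eq_planeWave (L : StrongDual ℝ (ℝ × ℝ)) (q : ℝ × ℝ) :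
    cexp (L q * I) = planeWave (L (1, 0), L (0, 1)) q := by
  have h : L q = q.1 * L (1, 0) + q.2 * L (0, 1) := by
    conv_lhs => rw [show q = q.1 • ((1, 0) : ℝ × ℝ) + q.2 • ((0, 1) : ℝ × ℝ) by ext <;> simp]
    rw [map_add, map_smul, map_smul, smul_eq_mul, smul_eq_mul]
  rw [h, planeWave]
  congr 1
  push_cast
  ring

/-- With `G` the Gaussian weight, this is `Gρ = Gp` with the negative part of `p` moved to the left,
since the sign of `p` is not yet known. As `p` is bounded, the factor `G` makes every measure
finite, so equal characteristic functions suffice. -/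
theorem withDensity_gaussWeight_add_eq [IsFiniteMeasure ρ] (hφ : Integrable (planeCharFun ρ)) :
    ρ.withDensity (fun q => ((gaussWeight q).toNNReal : ENNReal))
      + volume.withDensity (fun q => (((gaussWeight q).toNNReal *
          (-(inversionDensity ρ q).re).toNNReal : ℝ≥0) : ENNReal))
      = volume.withDensity (fun q => (((gaussWeight q).toNNReal *
          ((inversionDensity ρ q).re).toNNReal : ℝ≥0) : ENNReal)) := by
  obtain ⟨C, hC⟩ := exists_norm_inversionDensity_le ρ
  have hcont : Continuous (fun q => (inversionDensity ρ q).re) :=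
    Complex.continuous_re.comp (continuous_inversionDensity hφ)
  have hint : Integrable (fun q => gaussWeight q * (inversionDensity ρ q).re) :=
    integrable_gaussWeight.mul_bdd (c := C) hcont.aestronglyMeasurable
      (ae_of_all _ fun q => (Complex.abs_re_le_norm _).trans (hC q))
  have hfin : ∀ {μ : Measure (ℝ × ℝ)} {f : ℝ × ℝ → ℝ}, Integrable (fun q => gaussWeight q * f q) μ →
      IsFiniteMeasure (μ.withDensity (fun q => (((gaussWeight q).toNNReal *
        (f q).toNNReal : ℝ≥0) : ENNReal))) := by
    intro μ f hf
    simp_rw [← Real.toNNReal_mul (gaussWeight_pos _).le]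
    exact isFiniteMeasure_withDensity_ofReal hf.2
  have hfG : IsFiniteMeasure (ρ.withDensity (fun q => ((gaussWeight q).toNNReal : ENNReal))) :=
    isFiniteMeasure_withDensity_ofReal
      (Integrable.of_bound (C := 1) continuous_gaussWeight.aestronglyMeasurable
        (ae_of_all _ fun q => by
          rw [Real.norm_eq_abs, abs_of_pos (gaussWeight_pos q)]
          exact gaussWeight_le_one q)).2
  have hfp := hfin hint
  have hfn := hfin (f := fun q => -(inversionDensity ρ q).re) (hint.neg.congr (ae_of_all _ fun q => by
    simp))
  have hwave : ∀ {μ : Measure (ℝ × ℝ)}, IsFiniteMeasure μ → ∀ ξ : ℝ × ℝ,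
      Integrable (fun q => planeWave ξ q) μ := fun _ ξ =>
    Integrable.of_bound (C := 1) (Continuous.aestronglyMeasurable (by fun_prop))
      (ae_of_all _ fun q => (norm_planeWave ξ q).le)
  have hmG : Measurable (fun q => (gaussWeight q).toNNReal) :=
    continuous_gaussWeight.measurable.real_toNNReal
  have hmp : Measurable (fun q => (gaussWeight q).toNNReal *
      ((inversionDensity ρ q).re).toNNReal) := hmG.mul hcont.measurable.real_toNNReal
  have hmn : Measurable (fun q => (gaussWeight q).toNNReal *
      (-(inversionDensity ρ q).re).toNNReal) := hmG.mul hcont.measurable.neg.real_toNNReal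
  refine Measure.ext_of_charFunDual (funext fun L => ?_)
  simp only [charFunDual_apply, cexp_dual_eq_planeWave]
  rw [integral_add_measure (hwave hfG _) (hwave hfn _)]
  have hn := (integrable_withDensity_iff_integrable_smul hmn).1
    (hwave hfn (L (1, 0), L (0, 1)))
  have hp := (integrable_withDensity_iff_integrable_smul hmp).1
    (hwave hfp (L (1, 0), L (0, 1)))
  rw [integral_withDensity_eq_integral_smul hmG, integral_withDensity_eq_integral_smul hmn,
    integral_withDensity_eq_integral_smul hmp, ← eq_sub_iff_add_eq, ← integral_sub hp hn]
  have h := integral_planeWave_mul_gaussWeight_measure hφ (L (1, 0), L (0, 1))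
  refine (Eq.trans ?_ h).trans ?_
  · refine integral_congr_ae (ae_of_all _ fun q => ?_)
    simp only [NNReal.smul_def, Complex.real_smul]
    rw [Real.coe_toNNReal _ (gaussWeight_pos q).le, mul_comm]
  · refine integral_congr_ae (ae_of_all _ fun q => ?_)
    simp only [NNReal.smul_def, Complex.real_smul, ← sub_mul, NNReal.coe_mul, ← Complex.ofReal_sub,
      ← mul_sub]
    rw [Real.coe_toNNReal _ (gaussWeight_pos q).le, ← ofReal_re_inversionDensity q,
      Real.coe_toNNReal', Real.coe_toNNReal', max_zero_sub_max_neg_zero_eq_self, Complex.ofReal_re]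
    push_cast
    ring

/-- A finite measure on the plane with an integrable characteristic function has the Fourier
inversion integral as its density. -/
theorem integral_eq_integral_mul_inversionDensity [IsFiniteMeasure ρ]
    (hφ : Integrable (planeCharFun ρ)) {g : ℝ × ℝ → ℂ} (hg : Integrable g) :
    ∫ q, g q ∂ρ = ∫ q, g q * inversionDensity ρ q := by
  obtain ⟨C, hC⟩ := exists_norm_inversionDensity_le ρ
  have hcont : Continuous (fun q => (inversionDensity ρ q).re) :=
    Complex.continuous_re.comp (continuous_inversionDensity hφ)
  have hmG : Measurable (fun q => (gaussWeight q).toNNReal) :=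
    continuous_gaussWeight.measurable.real_toNNReal
  have hmp : Measurable (fun q => (gaussWeight q).toNNReal *
      ((inversionDensity ρ q).re).toNNReal) := hmG.mul hcont.measurable.real_toNNReal
  have hmn : Measurable (fun q => (gaussWeight q).toNNReal *
      (-(inversionDensity ρ q).re).toNNReal) := hmG.mul hcont.measurable.neg.real_toNNReal
  -- The damped identity is tested on `g / G`, which removes the Gaussian.
  have hcancel : ∀ (f : ℝ) (q : ℝ × ℝ), ((gaussWeight q).toNNReal * f.toNNReal) •
      ((gaussWeight q)⁻¹ • g q) = (max f 0) • g q := by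
    intro f q
    rw [NNReal.smul_def, smul_smul, NNReal.coe_mul, Real.coe_toNNReal _ (gaussWeight_pos q).le,
      Real.coe_toNNReal', mul_right_comm, mul_inv_cancel₀ (gaussWeight_pos q).ne', one_mul]
  have hbdd : ∀ f : ℝ × ℝ → ℝ, Continuous f → (∀ q, |f q| ≤ C) →
      Integrable (fun q => (max (f q) 0) • g q) := fun f hf hfC =>
    hg.bdd_smul (φ := fun q => max (f q) 0) C
      (Continuous.aestronglyMeasurable (by fun_prop))
      (ae_of_all _ fun q => by
        rw [Real.norm_eq_abs, abs_of_nonneg (le_max_right _ _)]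
        exact (max_le (le_abs_self _) (abs_nonneg _)).trans (hfC q))
  have hip := hbdd _ hcont fun q => (Complex.abs_re_le_norm _).trans (hC q)
  have hin := hbdd (fun q => -(inversionDensity ρ q).re) hcont.neg fun q => by
    rw [abs_neg]; exact (Complex.abs_re_le_norm _).trans (hC q)
  have hi : Integrable (fun q => (gaussWeight q)⁻¹ • g q)
      (volume.withDensity (fun q => (((gaussWeight q).toNNReal *
        ((inversionDensity ρ q).re).toNNReal : ℝ≥0) : ENNReal))) := by
    rw [integrable_withDensity_iff_integrable_smul hmp]
    simpa only [hcancel] using hip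
  -- Integrability for the right-hand measure passes to both summands on the left; this gives
  -- integrability against `ρ` without assuming it.
  have hi' := hi
  rw [← withDensity_gaussWeight_add_eq hφ, integrable_add_measure] at hi'
  have h := congrArg (fun μ => ∫ q, (gaussWeight q)⁻¹ • g q ∂μ) (withDensity_gaussWeight_add_eq hφ)
  rw [integral_add_measure hi'.1 hi'.2, integral_withDensity_eq_integral_smul hmG,
    integral_withDensity_eq_integral_smul hmn, integral_withDensity_eq_integral_smul hmp,
    ← eq_sub_iff_add_eq] at h
  simp only [hcancel] at h
  rw [← integral_sub hip hin] at h
  convert h using 1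
  · refine integral_congr_ae (ae_of_all _ fun q => ?_)
    simp only [NNReal.smul_def, smul_smul]
    rw [Real.coe_toNNReal _ (gaussWeight_pos q).le, mul_inv_cancel₀ (gaussWeight_pos q).ne',
      one_smul]
  · refine integral_congr_ae (ae_of_all _ fun q => ?_)
    simp only [← sub_smul, max_zero_sub_max_neg_zero_eq_self]
    rw [Complex.real_smul, ofReal_re_inversionDensity, mul_comm]

/-- The Parseval formula for a finite measure with an integrable characteristic function. -/
theorem integral_eq_integral_planeCharFun_mul [IsFiniteMeasure ρ]
    (hφ : Integrable (planeCharFun ρ)) {g : ℝ × ℝ → ℂ} (hg : Integrable g) :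
    ∫ q, g q ∂ρ = 1 / (4 * Real.pi ^ 2) *
      ∫ η, planeCharFun ρ (-η) * ∫ q, planeWave η q * g q := by
  rw [integral_eq_integral_mul_inversionDensity hφ hg, integral_mul_inversionDensity hφ hg]

/-- The transform of `g` is continuous and bounded by the `L¹` norm of `g`. -/
theorem integrable_planeCharFun_mul (hφ : Integrable (planeCharFun ρ)) {g : ℝ × ℝ → ℂ}
    (hg : Integrable g) :
    Integrable (fun η => planeCharFun ρ (-η) * ∫ q, planeWave η q * g q) := by
  refine hφ.comp_neg.mul_bdd (c := ∫ q, ‖g q‖) ?_ (ae_of_all _ fun η => ?_)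
  · refine (continuous_of_dominated (bound := fun q => ‖g q‖) (fun η =>
      (integrable_planeWave_mul hg η).aestronglyMeasurable) (fun η => ae_of_all _ fun q => ?_)
      hg.norm (ae_of_all _ fun q => by fun_prop)).aestronglyMeasurable
    rw [norm_mul, norm_planeWave, one_mul]
  · refine (norm_integral_le_integral_norm _).trans_eq ?_
    simp [norm_planeWave]

end FourierInversion

/-! ### Exponential tilting and translation of the payoff. -/

section ContourShift

/-- The real exponential weight `e^{k₁ q₁ + k₂ q₂}`. -/
def tilt (k₁ k₂ : ℝ) (q : ℝ × ℝ) : ℝ := Real.exp (k₁ * q.1 + k₂ * q.2)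

theorem tilt_pos (k₁ k₂ : ℝ) (q : ℝ × ℝ) : 0 < tilt k₁ k₂ q := Real.exp_pos _

theorem measurable_tilt (k₁ k₂ : ℝ) : Measurable (tilt k₁ k₂) := by
  unfold tilt
  fun_prop

theorem tilt_neg_mul_tilt (k₁ k₂ : ℝ) (q : ℝ × ℝ) : tilt (-k₁) (-k₂) q * tilt k₁ k₂ q = 1 := by
  rw [tilt, tilt, ← Real.exp_add, Real.exp_eq_one_iff]
  ring

theorem cexp_linePoint (k₁ k₂ : ℝ) (ξ q : ℝ × ℝ) :
    cexp (I * (linePoint k₁ k₂ ξ).1 * q.1 + I * (linePoint k₁ k₂ ξ).2 * q.2)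
      = planeWave ξ q * tilt (-k₁) (-k₂) q := by
  rw [planeWave, tilt, Complex.ofReal_exp, ← Complex.exp_add]
  congr 1
  simp only [linePoint]
  push_cast
  linear_combination ((k₁ : ℂ) * q.1 + k₂ * q.2) * I_sq

/-- The Fourier pricing formula for a finite measure `ρ` of the plane: integration of `F` against
`ρ` as an integral along a multi-line. -/
theorem integral_eq_integral_multiLine {ρ : Measure (ℝ × ℝ)} [IsFiniteMeasure ρ]
    {F : ℝ × ℝ → ℝ} {k₁ k₂ : ℝ}
    (hF : linePoint k₁ k₂ 0 ∈ fourierDomain F) (hρ : linePoint (-k₁) (-k₂) 0 ∈ charDomain ρ)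
    (hφ : Integrable (fun ξ => charFunC ρ (linePoint (-k₁) (-k₂) ξ))) :
    Integrable (fun ξ => charFunC ρ (linePoint (-k₁) (-k₂) (-ξ)) * fourier F (linePoint k₁ k₂ ξ)) ∧
      ((∫ q, F q ∂ρ : ℝ) : ℂ) = 1 / (4 * Real.pi ^ 2) *
        ∫ ξ, charFunC ρ (linePoint (-k₁) (-k₂) (-ξ)) * fourier F (linePoint k₁ k₂ ξ) := by
  have hwave0 : ∀ q, planeWave 0 q = 1 := fun q => by simp [planeWave]
  have hm : Measurable (fun q => (tilt k₁ k₂ q).toNNReal) :=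
    (measurable_tilt k₁ k₂).real_toNNReal
  set ρ' : Measure (ℝ × ℝ) := ρ.withDensity (fun q => ((tilt k₁ k₂ q).toNNReal : ENNReal)) with hρ'
  have hcoe : ∀ q, ((tilt k₁ k₂ q).toNNReal : ℝ) = tilt k₁ k₂ q := fun q =>
    Real.coe_toNNReal _ (tilt_pos _ _ _).le
  -- At `ξ = 0` the plane wave is `1`, so membership in the domain says that the tilted measure is
  -- finite.
  have htilt : Integrable (tilt k₁ k₂) ρ := by
    simp only [charDomain, Set.mem_ofPred_eq, cexp_linePoint, hwave0, one_mul, neg_neg] at hρ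
    exact hρ.re
  have : IsFiniteMeasure ρ' := isFiniteMeasure_withDensity_ofReal htilt.2
  have hg : Integrable (fun q => (tilt (-k₁) (-k₂) q : ℂ) * F q) := by
    simpa only [fourierDomain, Set.mem_ofPred_eq, cexp_linePoint, hwave0, one_mul] using hF
  have hchar : ∀ ξ, charFunC ρ (linePoint (-k₁) (-k₂) ξ) = planeCharFun ρ' ξ := by
    intro ξ
    rw [planeCharFun, hρ', integral_withDensity_eq_integral_smul hm]
    refine integral_congr_ae (ae_of_all _ fun q => ?_)
    simp only [cexp_linePoint, neg_neg]
    rw [NNReal.smul_def, hcoe, Complex.real_smul, mul_comm]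
  have hfour : ∀ ξ, fourier F (linePoint k₁ k₂ ξ)
      = ∫ q, planeWave ξ q * ((tilt (-k₁) (-k₂) q : ℂ) * F q) := by
    intro ξ
    simp only [fourier, cexp_linePoint]
    simp only [mul_assoc]
  simp only [hchar, hfour] at hφ ⊢
  refine ⟨integrable_planeCharFun_mul hφ hg, ?_⟩
  rw [← integral_eq_integral_planeCharFun_mul hφ hg, hρ', integral_withDensity_eq_integral_smul hm,
    ← integral_complex_ofReal]
  refine integral_congr_ae (ae_of_all _ fun q => ?_)
  simp only [NNReal.smul_def, hcoe, Complex.real_smul]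
  rw [← mul_assoc, ← Complex.ofReal_mul, mul_comm (tilt k₁ k₂ q), tilt_neg_mul_tilt]
  simp

theorem cexp_translate (p : ℂ × ℂ) (a q : ℝ × ℝ) :
    cexp (I * p.1 * q.1 + I * p.2 * q.2)
      = cexp (-(I * p.1 * a.1 + I * p.2 * a.2)) *
        cexp (I * p.1 * ((q + a).1 : ℝ) + I * p.2 * ((q + a).2 : ℝ)) := by
  rw [← Complex.exp_add]
  congr 1
  simp only [Prod.fst_add, Prod.snd_add]
  push_cast
  ring

theorem mem_fourierDomain_translate {F : ℝ × ℝ → ℝ} {p : ℂ × ℂ} (h : p ∈ fourierDomain F)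
    (a : ℝ × ℝ) : p ∈ fourierDomain (fun q => F (q + a)) := by
  have := (Integrable.comp_add_right h a).const_mul
    (cexp (-(I * p.1 * a.1 + I * p.2 * a.2)))
  refine this.congr (ae_of_all _ fun q => ?_)
  simp only
  rw [cexp_translate p a q]
  exact (mul_assoc _ _ _).symm

theorem fourier_translate (F : ℝ × ℝ → ℝ) (p : ℂ × ℂ) (a : ℝ × ℝ) :
    fourier (fun q => F (q + a)) p
      = cexp (-(I * p.1 * a.1 + I * p.2 * a.2)) * fourier F p := by
  unfold fourier
  rw [← integral_add_right_eq_self (fun q : ℝ × ℝ => cexp (I * p.1 * q.1 + I * p.2 * q.2) * (F q : ℂ))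
    a, ← integral_const_mul]
  refine integral_congr_ae (ae_of_all _ fun q => ?_)
  simp only
  rw [cexp_translate p a q, mul_assoc]

end ContourShift

/-! ### The pricing integrand. -/

namespace DecoupledTimeChange

variable {Ω : Type*} {mΩ : MeasurableSpace Ω} {P : Measure Ω} {ℱ : Filtration ℝ≥0 mΩ}
  {D : DecoupledTimeChange P ℱ} {r S₀ : ℝ} {θ₀ : ℂ}

/-- Since `S_{t₀} > 0`, the power `S_{t₀}^{-iz}` is `e^{-iz Y_{t₀}}`, and the three prefactors
combine into the single exponential created by translating `F`. -/
theorem pricingIntegrand_eq [IsFiniteMeasure P] {𝓗 : MeasurableSpace Ω} {t₀ t : ℝ≥0}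
    {F : ℝ × ℝ → ℝ} {ω : Ω} (hpos : 0 < D.asset r S₀ θ₀ t₀ ω) (p : ℂ × ℂ) :
    D.pricingIntegrand r S₀ θ₀ 𝓗 t₀ t F ω p
      = D.Phi r S₀ θ₀ 𝓗 t₀ t ω (-p.1, -p.2) * fourier (fun q => F (q +
          (D.logPrice r S₀ θ₀ t₀ ω + r * ((t : ℝ) - t₀), D.realizedVar r S₀ θ₀ t₀ ω))) p := by
  have hne : (D.asset r S₀ θ₀ t₀ ω : ℂ) ≠ 0 := Complex.ofReal_ne_zero.2 hpos.ne'
  rw [pricingIntegrand, fourier_translate, Complex.cpow_def_of_ne_zero hne,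
    ← Complex.ofReal_log hpos.le, ← Complex.exp_add, ← Complex.exp_add, logPrice]
  rw [show ∀ a b c d : ℂ, a = b → a * c * d = c * (b * d) from fun a b c d h => by rw [h]; ring]
  congr 1
  push_cast
  ring

end DecoupledTimeChange

end

end DTCPricing

/-! ### The pricing formula. -/

theorem proposition4 {Ω : Type*} {mΩ : MeasurableSpace Ω} (P : Measure Ω)
    [IsProbabilityMeasure P]
    -- the filtration carrying the Lévy process, and the market information
    (ℱ 𝒢 : Filtration ℝ≥0 mΩ)
    (D : DTCPricing.DecoupledTimeChange P ℱ)
    (r S₀ : ℝ) (hS₀ : 0 < S₀) (θ₀ : ℂ) (hθ₀ : θ₀ ∈ D.naturalParameterSet)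
    (hreal : D.IsRealAsset r S₀ θ₀)
    (hadapted : Adapted 𝒢 (D.logPrice r S₀ θ₀))
    (t₀ t : ℝ≥0) (ht : t₀ < t)
    -- the payoff, with analytic Fourier transform in `Σ_F`
    (F : ℝ × ℝ → ℝ) (hF : Measurable F) (hFpos : ∀ q, 0 ≤ F q)
    (α₁ α₂ β₁ β₂ : EReal)
    (hFan : AnalyticOn ℂ (DTCPricing.fourier F)
      (DTCPricing.multiStrip (DTCPricing.fourierDomain F) α₁ α₂ β₁ β₂)) :
    ∀ᵐ ω ∂P, ∀ γ₁ γ₂ η₁ η₂ : EReal, ∀ SigmaF SigmaPhi : Set (ℂ × ℂ),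
      SigmaF = DTCPricing.multiStrip (DTCPricing.fourierDomain F) α₁ α₂ β₁ β₂ →
      SigmaPhi = DTCPricing.multiStrip
        (DTCPricing.charDomain (D.incrementLaw r S₀ θ₀ (𝒢 t₀) t₀ t ω)) γ₁ γ₂ η₁ η₂ →
      -- `F` is integrable for the conditional law of `(Y_t, ⟨Y⟩_t)` at time `t₀`
      Integrable F (D.stateLaw r S₀ θ₀ (𝒢 t₀) t ω) →
      AnalyticOn ℂ (D.Phi r S₀ θ₀ (𝒢 t₀) t₀ t ω) SigmaPhi →
      (SigmaF ∩ DTCPricing.conjSet SigmaPhi).Nonempty →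
      ∀ k₁ k₂ : ℝ, DTCPricing.multiLine k₁ k₂ ⊆ SigmaF ∩ DTCPricing.conjSet SigmaPhi →
        -- `Φ_{t₀}` is `L¹` along the conjugate multi-line, which lies in `Σ_Φ`
        Integrable (fun q : ℝ × ℝ =>
          D.Phi r S₀ θ₀ (𝒢 t₀) t₀ t ω (DTCPricing.linePoint (-k₁) (-k₂) q)) →
        Integrable (fun q : ℝ × ℝ =>
          D.pricingIntegrand r S₀ θ₀ (𝒢 t₀) t₀ t F ω (DTCPricing.linePoint k₁ k₂ q)) ∧
        ((∫ q, Real.exp (-(r * ((t : ℝ) - (t₀ : ℝ)))) * F q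
            ∂(D.stateLaw r S₀ θ₀ (𝒢 t₀) t ω) : ℝ) : ℂ)
          = ((Real.exp (-(r * ((t : ℝ) - (t₀ : ℝ)))) / (4 * Real.pi ^ 2) : ℝ) : ℂ) *
            ∫ x : ℝ, ∫ y : ℝ,
              D.pricingIntegrand r S₀ θ₀ (𝒢 t₀) t₀ t F ω (DTCPricing.linePoint k₁ k₂ (x, y)) := by
  
  -- The exceptional null sets are fixed before the strips and the multi-line are chosen.
  filter_upwards [DTCPricing.DecoupledTimeChange.stateLaw_ae_eq hreal hadapted t₀ t,
    hreal.ae_pos t₀] with ω hlaw hpos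
  rintro γ₁ γ₂ η₁ η₂ _ _ rfl rfl - - - k₁ k₂ hline hΦ
  -- The single point `(ik₁, ik₂)` suffices: absolute convergence depends only on imaginary parts.
  obtain ⟨⟨hdomF, -⟩, ⟨hdomΦ, -⟩⟩ := hline ⟨0, rfl⟩
  set a : ℝ × ℝ := (D.logPrice r S₀ θ₀ t₀ ω + r * ((t : ℝ) - t₀), D.realizedVar r S₀ θ₀ t₀ ω)
    with ha
  set ρ := D.incrementLaw r S₀ θ₀ (𝒢 t₀) t₀ t ω with hρ
  have hdomΦ' : DTCPricing.linePoint (-k₁) (-k₂) 0 ∈ DTCPricing.charDomain ρ := by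
    convert hdomΦ using 2 <;> simp [DTCPricing.linePoint]
  obtain ⟨hint, heq⟩ := DTCPricing.integral_eq_integral_multiLine
    (DTCPricing.mem_fourierDomain_translate hdomF a) hdomΦ' hΦ
  have hpt : (fun q : ℝ × ℝ => D.pricingIntegrand r S₀ θ₀ (𝒢 t₀) t₀ t F ω
      (DTCPricing.linePoint k₁ k₂ q)) = fun q => DTCPricing.charFunC ρ
        (DTCPricing.linePoint (-k₁) (-k₂) (-q)) *
          DTCPricing.fourier (fun q => F (q + a)) (DTCPricing.linePoint k₁ k₂ q) := by
    funext q
    rw [DTCPricing.DecoupledTimeChange.pricingIntegrand_eq hpos]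
    congr 2
    ext <;> simp [DTCPricing.linePoint] <;> ring
  rw [← hpt] at hint heq
  refine ⟨hint, ?_⟩
  -- Change of variables turns `F` under the translated law into `F(· + a)` under `ρ`; Fubini yields
  -- the iterated integral.
  rw [integral_const_mul, hlaw, integral_map (by fun_prop) hF.aestronglyMeasurable,
    Complex.ofReal_mul, heq, Measure.volume_eq_prod, integral_prod _ hint]
  push_cast
  ring
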